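/- Let $\mathscr H$ be a complex Hilbert space (of arbitrary dimension) and let $\mathscr A\subseteq \mathcal B(\mathscr H)$ be a $W^*$-algebra acting on $\mathscr H$, that is, a von Neumann algebra: a $*$-subalgebra of $\mathcal B(\mathscr H)$ that equals its double commutant. A state on $\mathscr A$ is a positive bounded linear functional $\omega$ with $\omega(1)=1$. A state is normal if it belongs to the predual $\mathscr A_*$, i.e. if it is continuous for the $\sigma$-weak topology, the coarsest topology that makes every functional $v\mapsto\sum_{n}\langle v x_n,y_n\rangle$ with $\sum_n\|x_n\|^2<\infty$ and $\sum_n\|y_n\|^2<\infty$ continuous. A state is a vector state if there is a vector $x\in\mathscr H$ with $\omega(v)=\langle vx,x\rangle$ for all $v\in\mathscr A$. For a subset $S$ of a topological vector space, put $$\sigma\text{-co}(S)=\Big\{\sum_{j=1}^\infty\lambda_j s_j:\ s_j\in S,\ \lambda_j>0,\ \sum_{j=1}^\infty\lambda_j=1\Big\},$$ where only convergent series are taken. Then, in the dual of $\mathscr A$ with its weak$^*$-topology (pointwise convergence on $\mathscr A$), the normal state space of $\mathscr A$ is the $\sigma$-convex hull of the set of vector states of $\mathscr A$. In other words, a linear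 functional on $\mathscr A$ is a normal state if and only if it is of the form $\sum_{j=1}^\infty\lambda_j\omega_j$ with vector states $\omega_j$, $\lambda_j>0$ and $\sum_{j=1}^\infty\lambda_j=1$. -/

import Mathlib

open Filter Topology
open scoped ComplexOrder

/-- The `σ`-convex hull of a subset `S` of a topological vector space: the set of all sums
`∑_{j ≥ 0} c j • s j` (limits of the partial sums) with `s j ∈ S`, `c j > 0` and `∑ c j = 1`. -/
def sigmaConvexHull {E : Type*} [AddCommGroup E] [Module ℂ E] [TopologicalSpace E]
    (S : Set E) : Set E :=
  {v | ∃ (c : ℕ → ℝ) (s : ℕ → E), (∀ j, s j ∈ S) ∧ (∀ j, 0 < c j) ∧ HasSum c 1 ∧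
    Tendsto (fun n => ∑ j ∈ Finset.range n, (c j : ℂ) • s j) atTop (𝓝 v)}

section VonNeumann

variable {H : Type*} [NormedAddCommGroup H] [InnerProductSpace ℂ H] [CompleteSpace H]

/-- The functional `a ↦ ∑ n, ⟨a (x n), y n⟩` on `B(H)` given by two square-summable sequences of
vectors (Mathlib's inner product is linear in its second argument). The series converges
absolutely. -/
noncomputable def sigmaWeakForm (x y : lp (fun _ : ℕ => H) 2) (a : H →L[ℂ] H) : ℂ :=
  ∑' n, inner ℂ (y n) (a (x n))

variable (H) in
/-- The `σ`-weak (ultraweak) topology on `B(H)`, that is, the weak* topology that `B(H)` has as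
the dual of the trace class operators: the coarsest topology for which all the functionals
`a ↦ ∑ n, ⟨a (x n), y n⟩` with `∑ ‖x n‖ ^ 2 < ∞` and `∑ ‖y n‖ ^ 2 < ∞` are continuous. -/
noncomputable abbrev sigmaWeakTopology : TopologicalSpace (H →L[ℂ] H) :=
  ⨅ (x : lp (fun _ : ℕ => H) 2) (y : lp (fun _ : ℕ => H) 2),
    TopologicalSpace.induced (sigmaWeakForm x y) inferInstance

namespace VonNeumannAlgebra

variable (A : VonNeumannAlgebra H)

/-- The dual space of bounded linear functionals on a von Neumann algebra, with the topology of
pointwise convergence on the algebra. -/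
abbrev Dual : Type _ := WeakDual ℂ A.toStarSubalgebra

/-- States: positive bounded linear functionals that take the value `1` at the unit. -/
def stateSpace : Set A.Dual :=
  {ω | (∀ a : A.toStarSubalgebra, 0 ≤ ω (star a * a)) ∧ ω 1 = 1}

/-- The predual `A_*` of a von Neumann algebra, as a set of functionals on the algebra: the normal
functionals, that is, those which are continuous for the `σ`-weak topology of `A`. -/
def normalFunctionals : Set A.Dual :=
  {ω | Continuous[TopologicalSpace.induced
      (fun a : A.toStarSubalgebra => (a : H →L[ℂ] H)) (sigmaWeakTopology H), inferInstance]
    (fun a : A.toStarSubalgebra => ω a)}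

/-- The normal state space: the states that lie in the predual. -/
def normalStateSpace : Set A.Dual := A.stateSpace ∩ A.normalFunctionals

/-- Vector states: states of the form `a ↦ ⟨a x, x⟩` for some vector `x` of the Hilbert space. -/
def vectorStates : Set A.Dual :=
  {ω | ω ∈ A.stateSpace ∧
    ∃ x : H, ∀ a : A.toStarSubalgebra, ω a = inner ℂ x ((a : H →L[ℂ] H) x)}

end VonNeumannAlgebra

end VonNeumann

/-!
A `σ`-convex combination `∑ c j • ω j` of vector states, with `ω j` given by the unit vector `x j`,
is `a ↦ ∑ ⟪√(c j) x j, a (√(c j) x j)⟫`, which is one of the functionals defining the `σ`-weak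
topology; so it is a normal state (`VonNeumannAlgebra.sigmaConvexHull_subset`).

Conversely, a `σ`-weakly continuous functional is a linear combination of the functionals
`sigmaWeakForm x y`, and hence equals one of them. Such a functional has the form `⟪y, π a x⟫` in the
amplified representation `π` of the algebra on the Hilbert sum of countably many copies of `H`. If it
is positive, polarization shows that it is dominated by the vector functional of `z = (x + y) / 2`.
A Radon-Nikodym argument then applies: on the cyclic subspace generated by `z` there is a positive
operator `T` with `⟪T (π a z), π b z⟫ = ω (star a * b)`. It commutes with `π`, so its square root does
too, and `w = √T z` satisfies `ω a = ⟪w, π a w⟫ = ∑ ⟪w n, a (w n)⟫`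
(`LinearMap.exists_vector_of_eq_inner`, `VonNeumannAlgebra.exists_sigmaWeakForm_self_eq`).
Normalizing the nonzero `w n` displays `ω` as a countable convex combination of vector states, and
splitting every term with geometric weights makes it an infinite series with positive coefficients
even if only finitely many `w n` are nonzero.
-/

/-! ### Positive functionals dominated by a vector functional -/

section PositiveFunctional

variable {R : Type*} [Ring R] [StarRing R] [Algebra ℂ R] [StarModule ℂ R]

/-- A positive functional makes `(a, b) ↦ ω (star a * b)` a Hermitian form, by polarization. -/
theorem LinearMap.conj_apply_star_mul_of_nonneg {ω : R →ₗ[ℂ] ℂ} (hω : ∀ a, 0 ≤ ω (star a * a))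
    (a b : R) : starRingEnd ℂ (ω (star b * a)) = ω (star a * b) := by
  have h0 := fun c => (Complex.nonneg_iff.1 (hω c)).2
  -- Positivity at `a + b` and at `a + i b` gives the imaginary and the real part.
  have h1 := h0 (a + b)
  have h2 := h0 (a + Complex.I • b)
  have ha := h0 a
  have hb := h0 b
  simp only [star_add, star_smul, add_mul, mul_add, map_add, smul_mul_assoc, mul_smul_comm,
    map_smul, Complex.add_im, smul_eq_mul, Complex.star_def, Complex.conj_I, Complex.mul_im,
    Complex.mul_re, Complex.neg_re, Complex.neg_im, Complex.I_re, Complex.I_im] at h1 h2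
  apply Complex.ext <;> simp only [Complex.conj_re, Complex.conj_im] <;> linarith

/-- The Cauchy-Schwarz inequality for the semi-inner product `(a, b) ↦ ω (star a * b)`. -/
theorem LinearMap.norm_apply_star_mul_sq_le {ω : R →ₗ[ℂ] ℂ} (hω : ∀ a, 0 ≤ ω (star a * a))
    (a b : R) :
    ‖ω (star a * b)‖ ^ 2 ≤ (ω (star a * a)).re * (ω (star b * b)).re := by
  let core : PreInnerProductSpace.Core ℂ R :=
    { inner := fun a b => ω (star a * b)
      conj_inner_symm := fun a b => ω.conj_apply_star_mul_of_nonneg hω a b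
      re_inner_nonneg := fun a => (Complex.nonneg_iff.1 (hω a)).1
      add_left := fun a b c => by simp [add_mul]
      smul_left := fun a b r => by simp }
  have h := @InnerProductSpace.Core.inner_mul_inner_self_le ℂ R _ _ _ core a b
  change ‖ω (star a * b)‖ * ‖ω (star b * a)‖ ≤ (ω (star a * a)).re * (ω (star b * b)).re at h
  rwa [← ω.conj_apply_star_mul_of_nonneg hω b a, Complex.norm_conj,
    ← ω.conj_apply_star_mul_of_nonneg hω a b, Complex.norm_conj, ← sq,
    ← Complex.norm_conj, ω.conj_apply_star_mul_of_nonneg hω] at h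

variable {M : Type*} [NormedAddCommGroup M] [InnerProductSpace ℂ M] [CompleteSpace M]

/-- A Radon-Nikodym operator: a positive functional dominated by `a ↦ ‖e a‖ ^ 2`, where `e` has dense
range, is represented by a positive operator `T` through `⟪T (e a), e b⟫ = ω (star a * b)`. -/
theorem LinearMap.exists_isPositive_inner_eq {ω : R →ₗ[ℂ] ℂ} (hω : ∀ a, 0 ≤ ω (star a * a))
    {e : R →ₗ[ℂ] M} (he : DenseRange e) (hle : ∀ a, (ω (star a * a)).re ≤ ‖e a‖ ^ 2) :
    ∃ T : M →L[ℂ] M, T.IsPositive ∧ ∀ a b, inner ℂ (T (e a)) (e b) = ω (star a * b) := by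
  have hbound : ∀ a b, ‖ω (star a * b)‖ ≤ ‖e a‖ * ‖e b‖ := fun a b => by
    refine abs_le_of_sq_le_sq' ?_ (by positivity) |>.2
    rw [mul_pow]
    exact (ω.norm_apply_star_mul_sq_le hω a b).trans
      (mul_le_mul (hle a) (hle b) (Complex.nonneg_iff.1 (hω b)).1 (by positivity))
  -- By Riesz, the bounded functional `e b ↦ ω (star a * b)` is the inner product with `t a`.
  have hex : ∀ a, ∃ t : M, ‖t‖ ≤ ‖e a‖ ∧ ∀ b, inner ℂ t (e b) = ω (star a * b) := fun a => by
    let f : R →ₗ[ℂ] ℂ := ω ∘ₗ LinearMap.mulLeft ℂ (star a)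
    refine ⟨(InnerProductSpace.toDual ℂ M).symm (f.extendOfNorm e), ?_, fun b => ?_⟩
    · rw [LinearIsometryEquiv.norm_map]
      exact LinearMap.opNorm_extendOfNorm_le he (norm_nonneg _) (hbound a)
    · rw [InnerProductSpace.toDual_symm_apply,
        LinearMap.extendOfNorm_eq he ⟨_, hbound a⟩]
      rfl
  choose t ht hinner using hex
  have heq : ∀ {u v : M}, (∀ b, inner ℂ u (e b) = inner ℂ v (e b)) → u = v := fun {u v} h =>
    ext_inner_right ℂ fun x => he.induction (P := fun x => inner ℂ u x = inner ℂ v x)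
      (by rintro _ ⟨b, rfl⟩; exact h b) (isClosed_eq (by fun_prop) (by fun_prop)) x
  let f : R →ₗ[ℂ] M :=
    { toFun := t
      map_add' := fun a b => heq fun c => by simp [hinner, add_mul]
      map_smul' := fun r a => heq fun c => by simp [hinner, mul_comm] }
  have hf : ∀ a, f.extendOfNorm e (e a) = t a :=
    LinearMap.extendOfNorm_eq he ⟨1, fun a => by rw [one_mul]; exact ht a⟩
  refine ⟨f.extendOfNorm e, ?_, fun a b => by rw [hf, hinner]⟩
  rw [ContinuousLinearMap.isPositive_iff_complex]
  intro x
  have h : 0 ≤ inner ℂ (f.extendOfNorm e x) x :=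
    he.induction (P := fun x => 0 ≤ inner ℂ (f.extendOfNorm e x) x)
      (by rintro _ ⟨b, rfl⟩; simpa [hf, hinner] using hω b)
      (isClosed_le (by fun_prop) (by fun_prop)) x
  exact ⟨(Complex.eq_re_of_ofReal_le h).symm, (Complex.nonneg_iff.1 h).1⟩

/-- For a `*`-compatible action `ρ` with cyclic vector `e 1`, the Radon-Nikodym operator `T` commutes
with `ρ`, hence so does its square root, and `w = √T (e 1)` implements `ω`. -/
theorem LinearMap.exists_vector_of_denseRange {ω : R →ₗ[ℂ] ℂ} (hω : ∀ a, 0 ≤ ω (star a * a))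
    {e : R →ₗ[ℂ] M} (he : DenseRange e) (hle : ∀ a, (ω (star a * a)).re ≤ ‖e a‖ ^ 2)
    (ρ : R → M →L[ℂ] M) (hρ : ∀ a x y, inner ℂ (ρ (star a) x) y = inner ℂ x (ρ a y))
    (hρe : ∀ a b, ρ a (e b) = e (a * b)) :
    ∃ w : M, ∀ a, ω a = inner ℂ w (ρ a w) := by
  obtain ⟨T, hT, hTe⟩ := ω.exists_isPositive_inner_eq hω he hle
  have hT0 : 0 ≤ T := (ContinuousLinearMap.nonneg_iff_isPositive T).2 hT
  have hcomm : ∀ c, Commute T (ρ c) := fun c => by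
    have : ∀ a b, inner ℂ (T (ρ c (e a))) (e b) = inner ℂ (ρ c (T (e a))) (e b) := fun a b => by
      rw [hρe, hTe, star_mul, mul_assoc, ← hTe, ← hρe, ← hρ, star_star]
    refine ContinuousLinearMap.ext fun x => ext_inner_right ℂ fun y => ?_
    refine he.induction (P := fun x => inner ℂ (T (ρ c x)) y = inner ℂ (ρ c (T x)) y) ?_
      (isClosed_eq (by fun_prop) (by fun_prop)) x
    rintro _ ⟨a, rfl⟩
    refine he.induction (P := fun y => inner ℂ (T (ρ c (e a))) y = inner ℂ (ρ c (T (e a))) y) ?_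
      (isClosed_eq (by fun_prop) (by fun_prop)) y
    rintro _ ⟨b, rfl⟩
    exact this a b
  have hS : (CFC.sqrt T).IsPositive :=
    (ContinuousLinearMap.nonneg_iff_isPositive _).1 (CFC.sqrt_nonneg T)
  have hSS : ∀ x, CFC.sqrt T (CFC.sqrt T x) = T x := fun x =>
    DFunLike.congr_fun (CFC.sqrt_mul_sqrt_self T hT0) x
  refine ⟨CFC.sqrt T (e 1), fun a => ?_⟩
  have hc : Commute (CFC.sqrt T) (ρ a) := (hcomm a).cfcₙ_nnreal _
  have hc' : ρ a (CFC.sqrt T (e 1)) = CFC.sqrt T (ρ a (e 1)) :=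
    (DFunLike.congr_fun hc.eq (e 1)).symm
  rw [hc', ← hS.inner_left_eq_inner_right, hSS, hρe, hTe]
  simp

/-- A positive functional dominated by the vector functional of `z` in a `*`-representation is itself a
vector functional: restrict the representation to the closed invariant subspace generated by `z`. -/
theorem LinearMap.exists_vector_of_le {ω : R →ₗ[ℂ] ℂ} (hω : ∀ a, 0 ≤ ω (star a * a))
    (π : R →⋆ₐ[ℂ] (M →L[ℂ] M)) (z : M) (hle : ∀ a, (ω (star a * a)).re ≤ ‖π a z‖ ^ 2) :
    ∃ w : M, ∀ a, ω a = inner ℂ w (π a w) := by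
  let e₀ : R →ₗ[ℂ] M :=
    (ContinuousLinearMap.apply ℂ M z).toLinearMap ∘ₗ π.toAlgHom.toLinearMap
  have he₀ : ∀ a, e₀ a = π a z := fun a => rfl
  -- The cyclic subspace generated by `z`.
  let N : Submodule ℂ M := (LinearMap.range e₀).topologicalClosure
  have : CompleteSpace N := (Submodule.isClosed_topologicalClosure _).completeSpace_coe
  have hmem : ∀ a, e₀ a ∈ N := fun a =>
    Submodule.le_topologicalClosure _ (LinearMap.mem_range_self e₀ a)
  let e : R →ₗ[ℂ] N := e₀.codRestrict N hmem
  have he : DenseRange e := by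
    rw [denseRange_iff_closure_range, Set.eq_univ_iff_forall]
    rintro ⟨x, hx⟩
    rw [closure_subtype, ← Set.range_comp]
    exact hx
  have hinv : ∀ a, ∀ x ∈ N, π a x ∈ N := fun a x hx =>
    map_mem_closure (π a).continuous hx fun y hy => by
      obtain ⟨b, rfl⟩ := hy
      exact ⟨a * b, by simp [he₀]⟩
  obtain ⟨w, hw⟩ := ω.exists_vector_of_denseRange hω he hle
    (fun a => (π a ∘L N.subtypeL).codRestrict N fun x => hinv a x x.2)
    (fun a x y => by
      change inner ℂ (π (star a) x) (y : M) = inner ℂ (x : M) (π a y)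
      rw [map_star, ContinuousLinearMap.star_eq_adjoint, ContinuousLinearMap.adjoint_inner_left])
    (fun a b => Subtype.ext (by
      change π a (π b z) = π (a * b) z
      rw [map_mul]; rfl))
  exact ⟨w, hw⟩

/-- A positive functional of the form `a ↦ ⟪y, π a x⟫` is a vector functional. By polarization it is
dominated by the vector functional of `(x + y) / 2`. -/
theorem LinearMap.exists_vector_of_eq_inner {ω : R →ₗ[ℂ] ℂ} (hω : ∀ a, 0 ≤ ω (star a * a))
    (π : R →⋆ₐ[ℂ] (M →L[ℂ] M)) (x y : M) (h : ∀ a, ω a = inner ℂ y (π a x)) :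
    ∃ w : M, ∀ a, ω a = inner ℂ w (π a w) := by
  refine ω.exists_vector_of_le hω π ((2⁻¹ : ℂ) • (x + y)) fun a => ?_
  have h1 : ω (star a * a) = inner ℂ (π a y) (π a x) := by
    rw [h, map_mul, map_star, ContinuousLinearMap.star_eq_adjoint, mul_apply_eq_comp,
      ContinuousLinearMap.adjoint_inner_right]
  have h2 := norm_add_sq (𝕜 := ℂ) (π a y) (π a x)
  have h3 := norm_sub_sq (𝕜 := ℂ) (π a y) (π a x)
  -- `4 re ⟪u, v⟫ = ‖u + v‖ ^ 2 - ‖u - v‖ ^ 2 ≤ ‖u + v‖ ^ 2` for `u = π a y` and `v = π a x`.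
  have h4 := sq_nonneg ‖π a y - π a x‖
  rw [map_smul, norm_smul, mul_pow, map_add, add_comm, h1]
  norm_num at h2 h3 ⊢
  linarith

end PositiveFunctional

/-! ### Amplification to a countable Hilbert sum -/

section Amplification

variable {H : Type*} [NormedAddCommGroup H]

theorem lp.summable_norm_sq (x : lp (fun _ : ℕ => H) 2) : Summable fun n => ‖x n‖ ^ 2 := by
  simpa using (lp.memℓp x).summable (by norm_num)

theorem memℓp_two_of_summable_norm_sq {ι : Type*} {x : ι → H} (h : Summable fun n => ‖x n‖ ^ 2) :
    Memℓp x 2 := memℓp_gen (by simpa using h)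

variable [InnerProductSpace ℂ H]

theorem memℓp_two_map (a : H →L[ℂ] H) (x : lp (fun _ : ℕ => H) 2) : Memℓp (fun n => a (x n)) 2 :=
  memℓp_two_of_summable_norm_sq <|
    ((lp.summable_norm_sq x).mul_left (‖a‖ ^ 2)).of_nonneg_of_le (fun _ => by positivity)
      fun n => by
        rw [← mul_pow]
        exact pow_le_pow_left₀ (norm_nonneg _) (a.le_opNorm _) 2

/-- The diagonal action of an operator on the Hilbert sum of countably many copies of `H`. -/
noncomputable def ContinuousLinearMap.diagonal (a : H →L[ℂ] H) :
    lp (fun _ : ℕ => H) 2 →L[ℂ] lp (fun _ : ℕ => H) 2 :=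
  LinearMap.mkContinuous
    { toFun := fun x => ⟨fun n => a (x n), memℓp_two_map a x⟩
      map_add' := fun x y => lp.ext (funext fun n => map_add a (x n) (y n))
      map_smul' := fun r x => lp.ext (funext fun n => by simp) } ‖a‖
    fun x => by
      refine lp.norm_le_of_tsum_le (by norm_num) (by positivity) ?_
      have h := lp.norm_rpow_eq_tsum (p := 2) (by norm_num) x
      simp only [ENNReal.toReal_ofNat, Real.rpow_ofNat] at h ⊢
      rw [mul_pow, h, ← tsum_mul_left]
      refine Summable.tsum_le_tsum (fun n => ?_) ?_ ((lp.summable_norm_sq x).mul_left _)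
      · rw [← mul_pow]
        exact pow_le_pow_left₀ (norm_nonneg _) (a.le_opNorm _) 2
      · exact lp.summable_norm_sq ⟨fun n => a (x n), memℓp_two_map a x⟩

@[simp]
theorem ContinuousLinearMap.diagonal_apply (a : H →L[ℂ] H) (x : lp (fun _ : ℕ => H) 2) (n : ℕ) :
    a.diagonal x n = a (x n) := rfl

theorem inner_diagonal_eq_sigmaWeakForm (x y : lp (fun _ : ℕ => H) 2) (a : H →L[ℂ] H) :
    inner ℂ y (a.diagonal x) = sigmaWeakForm x y a := lp.inner_eq_tsum _ _

theorem hasSum_sigmaWeakForm (x y : lp (fun _ : ℕ => H) 2) (a : H →L[ℂ] H) :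
    HasSum (fun n => inner ℂ (y n) (a (x n))) (sigmaWeakForm x y a) := by
  rw [← inner_diagonal_eq_sigmaWeakForm]
  exact lp.hasSum_inner y (a.diagonal x)

/-- The functional `sigmaWeakForm x y` as a linear map. -/
noncomputable def sigmaWeakFormₗ (x y : lp (fun _ : ℕ => H) 2) : (H →L[ℂ] H) →ₗ[ℂ] ℂ where
  toFun := sigmaWeakForm x y
  map_add' a b := by
    simp only [← inner_diagonal_eq_sigmaWeakForm, ← inner_add_right]; rfl
  map_smul' r a := by
    simp only [← inner_diagonal_eq_sigmaWeakForm, smul_eq_mul, RingHom.id_apply,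
      ← inner_smul_right]; rfl

/-- The functionals `sigmaWeakForm x y` are closed under addition: the sequences are merged along a
bijection `ℕ ⊕ ℕ ≃ ℕ`. -/
theorem exists_sigmaWeakForm_eq_add (x y x' y' : lp (fun _ : ℕ => H) 2) :
    ∃ x'' y'' : lp (fun _ : ℕ => H) 2,
      ∀ a, sigmaWeakForm x'' y'' a = sigmaWeakForm x y a + sigmaWeakForm x' y' a := by
  let E := Equiv.natSumNatEquivNat
  have hmem : ∀ u v : lp (fun _ : ℕ => H) 2, Memℓp (fun n => Sum.elim (⇑u) (⇑v) (E.symm n)) 2 :=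
    fun u v => memℓp_two_of_summable_norm_sq <|
      (E.symm.summable_iff (f := fun i => ‖Sum.elim (⇑u) (⇑v) i‖ ^ 2)).2 <|
        Summable.sum _ (lp.summable_norm_sq u) (lp.summable_norm_sq v)
  refine ⟨⟨_, hmem x x'⟩, ⟨_, hmem y y'⟩, fun a => ?_⟩
  refine (hasSum_sigmaWeakForm _ _ a).unique ?_
  exact (E.symm.hasSum_iff
    (f := fun i => inner ℂ (Sum.elim (⇑y) (⇑y') i) (a (Sum.elim (⇑x) (⇑x') i)))).2 <|
      HasSum.sum (hasSum_sigmaWeakForm x y a) (hasSum_sigmaWeakForm x' y' a)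

/-- Each term of a convergent series may be split into countably many parts with weights of sum `1`. -/
theorem HasSum.mul_ofReal_of_hasSum_one {ι : Type*} {f : ι → ℂ} {v : ℂ} (hf : HasSum f v)
    {g : ℕ → ℝ} (hg : HasSum g 1) : HasSum (fun p : ι × ℕ => f p.1 * (g p.2 : ℂ)) v := by
  have hg' : HasSum (fun k => (g k : ℂ)) ((1 : ℝ) : ℂ) := Complex.hasSum_ofReal.2 hg
  have hfn := hf.summable.norm
  have hgn := hg'.summable.norm
  have h : Summable fun p : ι × ℕ => f p.1 * (g p.2 : ℂ) :=
    summable_mul_of_summable_norm (f := f) (g := fun k => (g k : ℂ)) hfn hgn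
  have h' := hf.mul hg' h
  rwa [Complex.ofReal_one, mul_one] at h'

variable [CompleteSpace H]

variable (H) in
/-- The representation of `B(H)` on the Hilbert sum of countably many copies of `H`. -/
noncomputable def amplification :
    (H →L[ℂ] H) →⋆ₐ[ℂ] (lp (fun _ : ℕ => H) 2 →L[ℂ] lp (fun _ : ℕ => H) 2) where
  toFun := ContinuousLinearMap.diagonal
  map_one' := rfl
  map_mul' _ _ := rfl
  map_zero' := rfl
  map_add' _ _ := rfl
  commutes' _ := rfl
  map_star' a := by
    rw [ContinuousLinearMap.star_eq_adjoint, ContinuousLinearMap.star_eq_adjoint,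
      ContinuousLinearMap.eq_adjoint_iff]
    intro x y
    simp [lp.inner_eq_tsum, ContinuousLinearMap.adjoint_inner_left]

end Amplification

/-! ### Normal functionals and normal states -/

namespace VonNeumannAlgebra

variable {H : Type*} [NormedAddCommGroup H] [InnerProductSpace ℂ H] [CompleteSpace H]
variable {A : VonNeumannAlgebra H}

theorem mem_normalFunctionals_of_eq {ω : A.Dual} (x y : lp (fun _ : ℕ => H) 2)
    (h : ∀ a, ω a = sigmaWeakForm x y a) : ω ∈ A.normalFunctionals := by
  rw [normalFunctionals, Set.mem_ofPred_eq, funext h]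
  have h1 : Continuous[sigmaWeakTopology H, inferInstance] (sigmaWeakForm x y) :=
    continuous_iInf_dom (continuous_iInf_dom continuous_induced_dom)
  exact @Continuous.comp _ _ _ (TopologicalSpace.induced _ (sigmaWeakTopology H))
    (sigmaWeakTopology H) _ _ _ h1 continuous_induced_dom

/-- A normal functional is given by a single pair of square-summable sequences: `σ`-weak continuity puts
it in the linear span of the functionals `sigmaWeakForm x y`, which is just the set of them. -/
theorem exists_eq_of_mem_normalFunctionals {ω : A.Dual} (hω : ω ∈ A.normalFunctionals) :
    ∃ x y : lp (fun _ : ℕ => H) 2, ∀ a, ω a = sigmaWeakForm x y a := by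
  let ι := lp (fun _ : ℕ => H) 2 × lp (fun _ : ℕ => H) 2
  let f : ι → A.toStarSubalgebra →ₗ[ℂ] ℂ := fun p =>
    sigmaWeakFormₗ p.1 p.2 ∘ₗ A.toStarSubalgebra.subtype.toAlgHom.toLinearMap
  let φ : A.toStarSubalgebra →ₗ[ℂ] ℂ := (WeakDual.toStrongDual ω).toLinearMap
  have htop : TopologicalSpace.induced (fun a : A.toStarSubalgebra => (a : H →L[ℂ] H))
      (sigmaWeakTopology H) = ⨅ p, TopologicalSpace.induced (f p) inferInstance := by
    simp only [sigmaWeakTopology, induced_iInf, induced_compose]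
    exact (iInf_prod (f := fun p => TopologicalSpace.induced (f p) inferInstance)).symm
  have hφ : φ ∈ Submodule.span ℂ (Set.range f) := by
    rw [LinearMap.mem_span_iff_continuous, ← htop]
    exact hω
  suffices ∃ x y : lp (fun _ : ℕ => H) 2, ∀ a, φ a = sigmaWeakForm x y a from this
  clear_value φ
  induction hφ using Submodule.span_induction with
  | mem g hg => obtain ⟨p, rfl⟩ := hg; exact ⟨p.1, p.2, fun a => rfl⟩
  | zero => exact ⟨0, 0, fun a => by simp [sigmaWeakForm]⟩
  | add g g' _ _ hg hg' =>
    obtain ⟨x, y, h⟩ := hg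
    obtain ⟨x', y', h'⟩ := hg'
    obtain ⟨x'', y'', h''⟩ := exists_sigmaWeakForm_eq_add x y x' y'
    exact ⟨x'', y'', fun a => by rw [h'', ← h, ← h']; rfl⟩
  | smul r g _ hg =>
    obtain ⟨x, y, h⟩ := hg
    refine ⟨r • x, y, fun a => ?_⟩
    rw [LinearMap.smul_apply, h, ← inner_diagonal_eq_sigmaWeakForm,
      ← inner_diagonal_eq_sigmaWeakForm, map_smul, inner_smul_right, smul_eq_mul]

/-- A normal state is `a ↦ ∑ n, ⟪w n, a (w n)⟫` for a single square-summable sequence `w`. -/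
theorem exists_sigmaWeakForm_self_eq {ω : A.Dual} (hω : ω ∈ A.normalStateSpace) :
    ∃ w : lp (fun _ : ℕ => H) 2, ∀ a, ω a = sigmaWeakForm w w a := by
  obtain ⟨x, y, h⟩ := exists_eq_of_mem_normalFunctionals hω.2
  let φ : A.toStarSubalgebra →ₗ[ℂ] ℂ := (WeakDual.toStrongDual ω).toLinearMap
  obtain ⟨w, hw⟩ := φ.exists_vector_of_eq_inner hω.1.1
    ((amplification H).comp A.toStarSubalgebra.subtype) x y
    fun a => (h a).trans (inner_diagonal_eq_sigmaWeakForm x y a).symm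
  exact ⟨w, fun a => (hw a).trans (inner_diagonal_eq_sigmaWeakForm w w a)⟩

/-! ### Vector states and `σ`-convex combinations -/

theorem Dual.sum_smul_apply {ι : Type*} (t : Finset ι) (c : ι → ℂ) (s : ι → A.Dual)
    (a : A.toStarSubalgebra) : (∑ j ∈ t, c j • s j) a = ∑ j ∈ t, c j * s j a := by
  change WeakDual.toStrongDual (∑ j ∈ t, c j • s j) a = _
  rw [map_sum, sum_apply]
  rfl

theorem norm_eq_one_of_inner_mem_stateSpace {ω : A.Dual} (hω : ω ∈ A.stateSpace) {x : H}
    (hx : ∀ a : A.toStarSubalgebra, ω a = inner ℂ x ((a : H →L[ℂ] H) x)) : ‖x‖ = 1 := by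
  have h := (hx 1).symm.trans hω.2
  change inner ℂ x x = 1 at h
  rw [inner_self_eq_norm_sq_to_K] at h
  have : ‖x‖ ^ 2 = 1 := Complex.ofReal_injective (by simpa using h)
  exact (pow_eq_one_iff_of_nonneg (norm_nonneg x) two_ne_zero).1 this

theorem exists_mem_vectorStates {x : H} (hx : ‖x‖ = 1) :
    ∃ ω ∈ A.vectorStates, ∀ a : A.toStarSubalgebra, ω a = inner ℂ x ((a : H →L[ℂ] H) x) := by
  let T : A.toStarSubalgebra →ₗ[ℂ] (H →L[ℂ] H) := A.toStarSubalgebra.subtype.toAlgHom.toLinearMap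
  let ω : A.Dual := StrongDual.toWeakDual
    ((innerSL ℂ x ∘L ContinuousLinearMap.apply ℂ H x) ∘L ⟨T, continuous_subtype_val⟩)
  have hω : ∀ a : A.toStarSubalgebra, ω a = inner ℂ x ((a : H →L[ℂ] H) x) := fun a => rfl
  refine ⟨ω, ⟨⟨fun a => ?_, ?_⟩, x, hω⟩, hω⟩
  · have : ω (star a * a) = inner ℂ ((a : H →L[ℂ] H) x) ((a : H →L[ℂ] H) x) :=
      ContinuousLinearMap.adjoint_inner_right (a : H →L[ℂ] H) x ((a : H →L[ℂ] H) x)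
    rw [this]
    exact ContinuousLinearMap.isPositive_one.inner_nonneg_right _
  · rw [hω]
    change inner ℂ x x = 1
    rw [inner_self_eq_norm_sq_to_K, hx]
    norm_num

variable (A)

theorem sigmaConvexHull_subset : sigmaConvexHull A.vectorStates ⊆ A.normalStateSpace := by
  rintro ω ⟨c, s, hs, hc, hc1, hlim⟩
  have heval : ∀ a, Tendsto (fun n => ∑ j ∈ Finset.range n, (c j : ℂ) * s j a) atTop
      (𝓝 (ω a)) := fun a =>
    (((WeakDual.eval_continuous a).tendsto ω).comp hlim).congr fun n =>
      Dual.sum_smul_apply _ _ _ _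
  choose x hx using fun j => (hs j).2
  have hnorm : ∀ j, ‖x j‖ = 1 := fun j => norm_eq_one_of_inner_mem_stateSpace (hs j).1 (hx j)
  refine ⟨⟨fun a => ?_, ?_⟩, ?_⟩
  · refine ge_of_tendsto' (heval _) fun n => Finset.sum_nonneg fun j _ => mul_nonneg ?_ ?_
    · exact_mod_cast (hc j).le
    · exact (hs j).1.1 a
  · refine tendsto_nhds_unique (heval 1) ?_
    have := (Complex.continuous_ofReal.tendsto 1).comp hc1.tendsto_sum_nat
    rw [Complex.ofReal_one] at this
    refine this.congr fun n => ?_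
    simp [(hs _).1.2]
  -- The sum is the `σ`-weakly continuous functional given by the sequence `√(c j) • x j` of vectors.
  · let w : lp (fun _ : ℕ => H) 2 := ⟨fun j => ((√(c j) : ℝ) : ℂ) • x j,
      memℓp_two_of_summable_norm_sq <| hc1.summable.congr fun j => by
        rw [norm_smul, hnorm, mul_one, Complex.norm_real, Real.norm_eq_abs, sq_abs,
          Real.sq_sqrt (hc j).le]⟩
    refine mem_normalFunctionals_of_eq w w fun a => tendsto_nhds_unique (heval a) ?_
    refine (hasSum_sigmaWeakForm w w a).tendsto_sum_nat.congr fun n =>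
      Finset.sum_congr rfl fun j _ => ?_
    change inner ℂ (((√(c j) : ℝ) : ℂ) • x j) ((a : H →L[ℂ] H) (((√(c j) : ℝ) : ℂ) • x j)) = _
    rw [map_smul, inner_smul_left, inner_smul_right, hx, Complex.conj_ofReal, ← mul_assoc,
      ← Complex.ofReal_mul, Real.mul_self_sqrt (hc j).le]

theorem normalStateSpace_subset_sigmaConvexHull :
    A.normalStateSpace ⊆ sigmaConvexHull A.vectorStates := by
  intro ω hω
  obtain ⟨w, hw⟩ := exists_sigmaWeakForm_self_eq hω
  -- Vanishing `w n` cannot be normalized and are discarded.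
  let S := {n : ℕ // w n ≠ 0}
  have hw' : ∀ a : A.toStarSubalgebra,
      HasSum (fun n : S => inner ℂ (w n) ((a : H →L[ℂ] H) (w n))) (ω a) := fun a => by
    rw [hw]
    refine (hasSum_subtype_iff_of_support_subset (s := {n : ℕ | w n ≠ 0})
      fun n hn hn0 => hn ?_).2 (hasSum_sigmaWeakForm w w a)
    rw [hn0, inner_zero_left]
  have hne : Nonempty S := by
    by_contra hS
    rw [not_nonempty_iff] at hS
    have h := (hw' 1).unique hasSum_empty
    rw [hω.1.2] at h
    exact one_ne_zero h
  have hunit : ∀ n : S, ‖((‖w n‖⁻¹ : ℝ) : ℂ) • w n‖ = 1 := fun n => by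
    rw [norm_smul, Complex.norm_real, norm_inv, norm_norm, inv_mul_cancel₀ (norm_ne_zero_iff.2 n.2)]
  choose v hv hva using fun n => exists_mem_vectorStates (A := A) (hunit n)
  have hwv : ∀ (a : A.toStarSubalgebra) (n : S),
      inner ℂ (w n) ((a : H →L[ℂ] H) (w n)) = ((‖w n‖ ^ 2 : ℝ) : ℂ) * v n a := fun a n => by
    have : (‖w n‖ : ℂ) ≠ 0 := by exact_mod_cast norm_ne_zero_iff.2 n.2
    rw [hva, map_smul, inner_smul_left, inner_smul_right, Complex.conj_ofReal]
    push_cast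
    field_simp
  -- The index set `S × ℕ` is countably infinite even if `S` is finite, and the geometric weights
  -- `g` split each term of the series into infinitely many positive multiples.
  obtain ⟨_⟩ := nonempty_denumerable (S × ℕ)
  let E : ℕ ≃ S × ℕ := (Denumerable.eqv (S × ℕ)).symm
  obtain ⟨g, hg0, hg⟩ : ∃ g : ℕ → ℝ, (∀ k, 0 < g k) ∧ HasSum g 1 :=
    ⟨_, fun k => by positivity, hasSum_geometric_two' 1⟩
  let c : ℕ → ℝ := fun j => ‖w (E j).1‖ ^ 2 * g (E j).2
  have hsum : ∀ a, HasSum (fun j => (c j : ℂ) * v (E j).1 a) (ω a) := fun a => by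
    have h := E.hasSum_iff.2 ((hw' a).mul_ofReal_of_hasSum_one hg)
    refine h.congr_fun fun j => ?_
    rw [Function.comp_apply, hwv, Complex.ofReal_mul]
    ring
  refine ⟨c, fun j => v (E j).1, fun j => hv _, fun j => ?_, ?_, ?_⟩
  · exact mul_pos (pow_pos (norm_pos_iff.2 (E j).1.2) 2) (hg0 _)
  · refine Complex.hasSum_ofReal.1 ?_
    have h := hsum 1
    simpa only [hω.1.2, (hv _).1.2, mul_one, Complex.ofReal_one] using h
  · rw [tendsto_iff_forall_eval_tendsto_topDualPairing]
    exact fun a => (hsum a).tendsto_sum_nat.congr fun n => (Dual.sum_smul_apply _ _ _ _).symm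

end VonNeumannAlgebra

theorem mainTheorem6 {H : Type*} [NormedAddCommGroup H] [InnerProductSpace ℂ H]
    [CompleteSpace H] (A : VonNeumannAlgebra H) :
    A.normalStateSpace = sigmaConvexHull A.vectorStates :=
  A.normalStateSpace_subset_sigmaConvexHull.antisymm A.sigmaConvexHull_subset
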